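/- All graphs are finite and simple. A graph is \emph{$1$-planar} if it can be drawn in the plane (vertices as distinct points, edges as simple arcs joining their ends and containing no other vertex) such that each edge is crossed at most once. It is \emph{perfect} if every induced subgraph has chromatic number equal to its clique number. A \emph{separator} of $G$ is a set $S\subseteq V(G)$ such that $G-S$ is disconnected; the \emph{connectivity} $\kappa(G)$ is the minimum size of a separator if $G$ is not complete, and $|V(G)|-1$ if $G$ is complete. \textbf{Theorem.} For every positive integer $k\le 5$ there exist infinitely many pairwise non-isomorphic non-Hamiltonian $1$-planar perfect graphs $G$ with $\kappa(G)=k$. -/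

import Mathlib

namespace SimpleGraph

variable {V : Type*}

/-- A graph is perfect if every induced subgraph has chromatic number equal to its clique
number. -/
def IsPerfect (G : SimpleGraph V) : Prop :=
  ∀ s : Set V, (G.induce s).chromaticNumber = ((G.induce s).cliqueNum : ℕ∞)

/-- `S` is a separator of `G` if `G - S` is disconnected, i.e. two of its vertices are not joined
by a path (the graph without vertices does not count as disconnected). -/
def IsSeparator (G : SimpleGraph V) (S : Finset V) : Prop :=
  ¬ (G.induce {v | v ∉ S}).Preconnected

open Classical in
/-- The connectivity of a finite graph: `|V| - 1` for a complete graph, and otherwise the minimum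
size of a separator. -/
noncomputable def connectivity [Fintype V] (G : SimpleGraph V) : ℕ :=
  if G = ⊤ then Fintype.card V - 1
  else sInf {m : ℕ | ∃ S : Finset V, G.IsSeparator S ∧ S.card = m}

/-- A drawing of `G` in the plane (identified with `ℂ`): the vertices are distinct points, every
edge is a simple arc joining its two ends, and no edge passes through a vertex other than its
ends. -/
structure Drawing (G : SimpleGraph V) where
  /-- the point that represents a vertex -/
  point : V → ℂ
  point_injective : Function.Injective point
  /-- the arc that represents an edge -/
  arc : G.edgeSet → C(unitInterval, ℂ)
  arc_injective : ∀ e, Function.Injective (arc e)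
  arc_ends : ∀ e, s(arc e 0, arc e 1) = Sym2.map point e
  arc_avoids : ∀ e t v, arc e t = point v → t = 0 ∨ t = 1

namespace Drawing

variable {G : SimpleGraph V}

/-- The open arc of an edge, without its ends. -/
def interior (D : G.Drawing) (e : G.edgeSet) : Set ℂ :=
  D.arc e '' Set.Ioo 0 1

/-- The crossings on the edge `e`: pairs of another edge `f` and a point that is interior to both
`e` and `f`. Every such common point counts, so an edge that meets `e` twice, or two edges that meet
`e` at the same point, give two crossings. -/
def crossings (D : G.Drawing) (e : G.edgeSet) : Set (G.edgeSet × ℂ) :=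
  {c | c.1 ≠ e ∧ c.2 ∈ D.interior e ∧ c.2 ∈ D.interior c.1}

end Drawing

/-- A graph is 1-planar if it can be drawn in the plane such that each edge is crossed at most
once. -/
def IsOnePlanar (G : SimpleGraph V) : Prop :=
  ∃ D : G.Drawing, ∀ e, (D.crossings e).Subsingleton

end SimpleGraph

/-! The examples are spanning subgraphs of one bipartite "double wheel". Each of two sides has a
hub, a ring of `m` inner and a ring of `2 * m` outer vertices; both sides share a middle ring of `2
* m` vertices, and edges join consecutive rings only. Hubs and outer rings form one colour class, of
size `4 * m + 2`; inner rings and middle ring form the other, of size `4 * m`. A Hamiltonian cycle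
alternates between the classes, so there is none (`IsHamiltonian.card_colorClass_eq`), and bipartite
graphs are perfect (`Coloring.isPerfect`). Both arguments, like 1-planarity, survive the deletion of
edges.

For 1-planarity (`isOnePlanar`), each side is drawn in a disc with its rings as concentric circles
and its edges as spirals between consecutive circles; only the extreme spirals of neighbouring
vertices cross. The two discs are glued along the middle ring by sending them to the two
half-planes.

For connectivity, vertex sets expand from ring to ring towards the middle, so four vertices never
separate the graph when `10 ≤ m` (`not_isSeparator`). Outer vertices have degree five; keeping `k`
edges at one of them gives connectivity exactly `k` (`exists_le_connectivity_eq`). Varying `m` gives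
infinitely many orders. -/

namespace SimpleGraph

/-! ### Bipartite graphs: perfection and Hamiltonian cycles -/

variable {V W : Type*}

/-- A graph with a proper 2-colouring is perfect. -/
theorem Coloring.isPerfect [Finite V] {G : SimpleGraph V} (c : G.Coloring Bool) :
    G.IsPerfect := by
  intro s
  have hcol : (G.induce s).Colorable 2 := by
    have : (G.induce s).Coloring Bool := c.comp (SimpleGraph.Embedding.induce s).toHom
    simpa using this.colorable
  refine le_antisymm ?_ cliqueNum_le_chromaticNumber
  rcases isEmpty_or_nonempty s with hs | hs
  · rw [chromaticNumber_eq_zero_of_isEmpty]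
    exact zero_le
  by_cases hbot : G.induce s = ⊥
  · rw [chromaticNumber_eq_one_iff.2 ⟨hbot, hs⟩]
    obtain ⟨v⟩ := hs
    have := IsClique.card_le_cliqueNum (G := G.induce s) (t := {v}) (tc := by simp)
    rw [Finset.card_singleton] at this
    exact_mod_cast this
  · obtain ⟨u, v, huv⟩ := ne_bot_iff_exists_adj.1 hbot
    classical
    have h2 := IsClique.card_le_cliqueNum (G := G.induce s) (t := {u, v})
      (tc := by
        rw [Finset.coe_pair, isClique_pair]
        exact fun _ => huv)
    rw [Finset.card_pair huv.ne] at h2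
    exact hcol.chromaticNumber_le.trans (by exact_mod_cast h2)

/-- Every dart flips the colour; the first vertices of the darts form `support.dropLast`, the second
ones `support.tail`. -/
theorem Walk.countP_dropLast_support_eq_countP_tail_support {G : SimpleGraph V} (c : G.Coloring Bool)
    {u v : V} (p : G.Walk u v) (b : Bool) :
    p.support.dropLast.countP (fun x => c x = b) =
      p.support.tail.countP (fun x => c x = !b) := by
  rw [← p.map_fst_darts, ← p.map_snd_darts, List.countP_map, List.countP_map]
  refine List.countP_congr fun d _ => ?_
  have := c.valid d.adj
  simp only [Function.comp, decide_eq_true_eq]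
  revert this
  cases c d.fst <;> cases c d.snd <;> cases b <;> simp

/-- In a Hamiltonian graph the classes of a proper 2-colouring have the same size. -/
theorem IsHamiltonian.card_colorClass_eq [Fintype V] [DecidableEq V] {G : SimpleGraph V}
    (hG : G.IsHamiltonian) (hV : Fintype.card V ≠ 1) (c : G.Coloring Bool) :
    Fintype.card {v // c v = true} = Fintype.card {v // c v = false} := by
  obtain ⟨a, p, hp⟩ := hG hV
  have hcount := (Walk.isHamiltonianCycle_iff_isCycle_and_support_count_tail_eq_one.1 hp).2
  have hcard : ∀ b : Bool,
      p.support.tail.countP (fun x => c x = b) = Fintype.card {v // c v = b} := by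
    intro b
    rw [Fintype.card_subtype, List.countP_eq_length_filter, ← List.toFinset_card_of_nodup]
    · congr 1
      ext v
      have : v ∈ p.support.tail := List.count_pos_iff.1 (by rw [hcount v]; exact one_pos)
      simp [this]
    · exact (List.nodup_iff_count_eq_one.2 fun v _ => hcount v).filter _
  -- The walk is closed, so dropping its last vertex or its first one removes the same vertex `a`.
  have hperm : p.support.dropLast.Perm p.support.tail := by
    have h1 : p.support.dropLast ++ [a] = p.support := by
      have := List.dropLast_append_getLast p.support_ne_nil
      rwa [p.getLast_support] at this
    have h2 : a :: p.support.tail = p.support := p.cons_tail_support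
    have h3 : (a :: p.support.dropLast).Perm (a :: p.support.tail) := by
      rw [h2]
      conv_rhs => rw [← h1]
      exact (List.perm_append_singleton _ _).symm
    exact h3.cons_inv
  rw [← hcard, ← hcard, ← hperm.countP_eq]
  exact p.countP_dropLast_support_eq_countP_tail_support c true

/-! ### Transfer along homomorphisms and isomorphisms -/

/-- 1-planarity passes to subgraphs. -/
theorem IsOnePlanar.of_hom {G : SimpleGraph V} {H : SimpleGraph W} (hG : G.IsOnePlanar)
    (f : H →g G) (hf : Function.Injective f) : H.IsOnePlanar := by
  obtain ⟨D, hD⟩ := hG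
  have hinj : Function.Injective f.mapEdgeSet := Hom.mapEdgeSet.injective f hf
  refine ⟨⟨D.point ∘ f, D.point_injective.comp hf, fun e => D.arc (f.mapEdgeSet e),
    fun e => D.arc_injective _, fun e => ?_, fun e t v h => D.arc_avoids _ t _ h⟩, ?_⟩
  · rw [D.arc_ends, ← Sym2.map_map]
    rfl
  · rintro e ⟨c, z⟩ hc ⟨c', z'⟩ hc'
    have h1 : (f.mapEdgeSet c, z) ∈ D.crossings (f.mapEdgeSet e) :=
      ⟨hinj.ne hc.1, hc.2.1, hc.2.2⟩
    have h2 : (f.mapEdgeSet c', z') ∈ D.crossings (f.mapEdgeSet e) :=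
      ⟨hinj.ne hc'.1, hc'.2.1, hc'.2.2⟩
    have := hD _ h1 h2
    rw [Prod.mk.injEq] at this
    rw [hinj this.1, this.2]

theorem IsSeparator.map_iso {G : SimpleGraph V} {H : SimpleGraph W} (e : G ≃g H) {S : Finset V}
    (hS : G.IsSeparator S) : H.IsSeparator (S.map e.toEquiv.toEmbedding) := by
  intro h
  refine hS ?_
  have hmem : ∀ v : V, v ∉ S ↔ e v ∉ S.map e.toEquiv.toEmbedding := fun v => by
    rw [not_iff_not]
    exact (Finset.mem_map' _).symm
  let φ : H.induce {v | v ∉ S.map e.toEquiv.toEmbedding} →g G.induce {v | v ∉ S} :=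
    ⟨fun w => ⟨e.symm w.1, (hmem _).2 (by rw [RelIso.apply_symm_apply]; exact w.2)⟩,
      fun {a b} hab => e.symm.map_adj_iff.2 hab⟩
  intro x y
  have hr := (h ⟨e x, (hmem _).1 x.2⟩ ⟨e y, (hmem _).1 y.2⟩).map φ
  convert hr
  · exact Subtype.ext (e.symm_apply_apply x.1).symm
  · exact Subtype.ext (e.symm_apply_apply y.1).symm

theorem Iso.connectivity_eq [Fintype V] [Fintype W] {G : SimpleGraph V} {H : SimpleGraph W}
    (e : G ≃g H) : G.connectivity = H.connectivity := by
  have htop : G = ⊤ ↔ H = ⊤ := by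
    simp only [eq_top_iff_forall_ne_adj]
    constructor
    · intro h a b hab
      exact e.symm.map_adj_iff.1 (h _ _ (e.symm.injective.ne hab))
    · intro h a b hab
      exact e.map_adj_iff.1 (h _ _ (e.injective.ne hab))
  unfold connectivity
  rw [e.card_eq]
  by_cases h : G = ⊤
  · rw [if_pos h, if_pos (htop.1 h)]
  · rw [if_neg h, if_neg (mt htop.2 h)]
    congr 1
    ext m
    constructor
    · rintro ⟨S, hS, rfl⟩
      exact ⟨_, hS.map_iso e, Finset.card_map _⟩
    · rintro ⟨S, hS, rfl⟩
      exact ⟨_, hS.map_iso e.symm, Finset.card_map _⟩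

/-! ### Lowering the connectivity at one vertex -/

/-- If no four vertices separate `G` and `v` has degree five, then keeping only `k ≤ 5` of the
edges at `v` gives a graph of connectivity `k`. -/
theorem exists_le_connectivity_eq [Fintype V] {G : SimpleGraph V}
    (hG : ∀ S : Finset V, S.card ≤ 4 → ¬ G.IsSeparator S) (hV : 7 ≤ Fintype.card V)
    (v : V) (N : Finset V) (hN : ∀ x, x ∈ N ↔ G.Adj v x) (hcard : N.card = 5)
    {k : ℕ} (hk : 0 < k) (hk5 : k ≤ 5) : ∃ H ≤ G, H.connectivity = k := by
  classical
  obtain ⟨K, hKN, hKk⟩ := Finset.exists_subset_card_eq (hcard ▸ hk5 : k ≤ N.card)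
  let H : SimpleGraph V :=
    { Adj := fun x y => G.Adj x y ∧ (x = v → y ∈ K) ∧ (y = v → x ∈ K)
      symm := ⟨fun x y h => ⟨h.1.symm, h.2.2, h.2.1⟩⟩
      loopless := ⟨fun x h => h.1.ne rfl⟩ }
  have hvK : v ∉ K := fun h => ((hN v).1 (hKN h)).ne rfl
  have hHv : ∀ x, H.Adj v x ↔ x ∈ K := fun x =>
    ⟨fun h => h.2.1 rfl, fun h => ⟨(hN x).1 (hKN h), fun _ => h, fun hx => absurd (hx ▸ h) hvK⟩⟩
  have hHne : ∀ x y, x ≠ v → y ≠ v → G.Adj x y → H.Adj x y := fun x y hx hy h =>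
    ⟨h, fun h => absurd h hx, fun h => absurd h hy⟩
  -- Here seven vertices are needed: `insert v K` may have six. The set `K` will separate `v` from
  -- `w`.
  obtain ⟨w, hw⟩ : ∃ w, w ∉ insert v K := by
    by_contra! h
    have := Finset.card_le_card (fun x _ => h x : Finset.univ ⊆ insert v K)
    have := Finset.card_insert_le v K
    rw [Finset.card_univ] at *
    omega
  rw [Finset.mem_insert, not_or] at hw
  have hsep : H.IsSeparator K := by
    intro h
    obtain ⟨p⟩ := h ⟨v, hvK⟩ ⟨w, hw.2⟩
    cases p with
    | nil => exact hw.1 rfl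
    | @cons _ x _ h' _ => exact x.2 ((hHv x.1).1 h')
  -- Only edges at `v` were deleted, so `G` and `H` agree once `v` is removed.
  have hrest : ∀ S : Finset V, S.card ≤ 4 → v ∈ S → ¬ H.IsSeparator S := by
    intro S hS hv hsep'
    refine hG S hS fun h => hsep' ?_
    have : G.induce {x | x ∉ S} ≤ H.induce {x | x ∉ S} := fun x y hxy =>
      hHne x.1 y.1 (fun h => x.2 (h ▸ hv)) (fun h => y.2 (h ▸ hv)) hxy
    exact h.mono this
  have hlow : ∀ S : Finset V, H.IsSeparator S → k ≤ S.card := by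
    intro S hS
    by_contra! hlt
    by_cases hv : v ∈ S
    · exact hrest S (by omega) hv hS
    -- For `k = 5` adding `v` to `S` could give five vertices, but then no edge was deleted. For `k
    -- ≤ 4`, `insert v S` has at most four vertices, so the rest is connected, and `v` hangs on to
    -- it by a neighbour `u ∈ K` outside `S`.
    rcases hk5.eq_or_lt with rfl | hk4
    · have hKN' : K = N := Finset.eq_of_subset_of_card_le hKN (by omega)
      refine hG S (by omega) fun h => hS ?_
      refine h.mono fun x y (hxy : G.Adj x y) => (⟨hxy, fun hx => ?_, fun hy => ?_⟩ : H.Adj x y)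
      · rw [hKN', hN, ← hx]
        exact hxy
      · rw [hKN', hN, ← hy]
        exact hxy.symm
    · have hpre : (H.induce {x | x ∉ insert v S}).Preconnected := by
        by_contra hcon
        exact hrest (insert v S) ((Finset.card_insert_le _ _).trans (by omega))
          (Finset.mem_insert_self _ _) hcon
      have hins : ∀ x, x ∉ S → x ≠ v → x ∉ insert v S := fun x h1 h2 => by
        rw [Finset.mem_insert, not_or]
        exact ⟨h2, h1⟩
      obtain ⟨u, huK, huS⟩ := Finset.exists_mem_notMem_of_card_lt_card (hKk ▸ hlt)
      have huv : u ≠ v := fun h => hvK (h ▸ huK)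
      let φ : H.induce {x | x ∉ insert v S} →g H.induce {x | x ∉ S} :=
        ⟨fun x => ⟨x.1, fun h => x.2 (Finset.mem_insert_of_mem h)⟩, fun {_ _} h => h⟩
      have key : ∀ x : {x | x ∉ S}, (H.induce {x | x ∉ S}).Reachable ⟨u, huS⟩ x := by
        intro x
        by_cases hx : x.1 = v
        · have : (H.induce {x | x ∉ S}).Adj ⟨u, huS⟩ x := by
            change H.Adj u x.1
            rw [hx]
            exact ((hHv u).2 huK).symm
          exact this.reachable
        · exact (hpre ⟨u, hins u huS huv⟩ ⟨x.1, hins _ x.2 hx⟩).map φ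
      exact hS fun x y => (key x).symm.trans (key y)
  refine ⟨H, fun x y h => h.1, ?_⟩
  have hne : H ≠ ⊤ := by
    intro h
    have : H.Adj v w := by
      rw [h]
      exact Ne.symm hw.1
    exact hw.2 ((hHv w).1 this)
  rw [connectivity, if_neg hne]
  refine le_antisymm (Nat.sInf_le ⟨K, hsep, hKk⟩) (le_csInf ⟨k, K, hsep, hKk⟩ ?_)
  rintro _ ⟨S, hS, rfl⟩
  exact hlow S hS

end SimpleGraph

/-! ### The double wheel and its bipartition -/

/-- The vertices of the double wheel: two sides, each with a hub, a ring of `m` inner vertices and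
a ring of `2 * m` outer vertices, and a common ring of `2 * m` middle vertices. -/
inductive DoubleWheel (m : ℕ)
  | hub (s : Bool)
  | inner (s : Bool) (i : ZMod m)
  | outer (s : Bool) (p : ZMod m × Bool)
  | mid (p : ZMod m × Bool)

namespace DoubleWheel

variable {m : ℕ}

/-- The successor on a ring of `2 * m` elements, written as `ZMod m × Bool`. -/
def next : Equiv.Perm (ZMod m × Bool) where
  toFun p := if p.2 then (p.1 + 1, false) else (p.1, true)
  invFun p := if p.2 then (p.1, false) else (p.1 - 1, true)
  left_inv := by rintro ⟨i, _ | _⟩ <;> simp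
  right_inv := by rintro ⟨i, _ | _⟩ <;> simp

@[simp] theorem next_true (i : ZMod m) : next (i, true) = (i + 1, false) := rfl

@[simp] theorem next_false (i : ZMod m) : next (i, false) = (i, true) := rfl

@[simp] theorem next_symm_true (i : ZMod m) : next.symm (i, true) = (i, false) := rfl

@[simp] theorem next_symm_false (i : ZMod m) : next.symm (i, false) = (i - 1, true) := rfl

/-- The oriented edges of the double wheel, from the hubs towards the middle ring. -/
inductive Arrow (m : ℕ)
  | spoke (s : Bool) (i : ZMod m)
  | fan (s : Bool) (i : ZMod m) (d : Fin 4)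
  | link (s : Bool) (p : ZMod m × Bool) (d : Fin 3)

/-- The outer vertices that are adjacent to the inner vertex `i`. -/
def fanEnd (i : ZMod m) : Fin 4 → ZMod m × Bool :=
  ![(i - 1, true), (i, false), (i, true), (i + 1, false)]

/-- The middle vertices that are adjacent to the outer vertex `p`. -/
def linkEnd (p : ZMod m × Bool) : Fin 3 → ZMod m × Bool :=
  ![next.symm p, p, next p]

/-- The end of an edge that is closer to the hub. -/
def Arrow.src : Arrow m → DoubleWheel m
  | spoke s _ => hub s
  | fan s i _ => inner s i
  | link s p _ => outer s p

/-- The end of an edge that is closer to the middle ring. -/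
def Arrow.tgt : Arrow m → DoubleWheel m
  | spoke s i => inner s i
  | fan s i d => outer s (fanEnd i d)
  | link _ p d => mid (linkEnd p d)

/-- The two classes of the bipartition of the double wheel. -/
def color : DoubleWheel m → Bool
  | hub _ => true
  | inner _ _ => false
  | outer _ _ => true
  | mid _ => false

theorem Arrow.color_tgt (a : Arrow m) : color a.tgt = !color a.src := by
  cases a <;> rfl

/-- The double wheel. -/
def graph (m : ℕ) : SimpleGraph (DoubleWheel m) where
  Adj x y := ∃ a : Arrow m, (a.src = x ∧ a.tgt = y) ∨ (a.src = y ∧ a.tgt = x)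
  symm := ⟨fun _ _ ⟨a, h⟩ => ⟨a, h.symm⟩⟩
  loopless := ⟨by
    rintro x ⟨a, h⟩
    have h' : a.src = a.tgt := by rcases h with h | h <;> exact h.1.trans h.2.symm
    have := a.color_tgt
    rw [← h'] at this
    simp at this⟩

theorem Arrow.adj (a : Arrow m) : (graph m).Adj a.src a.tgt := ⟨a, Or.inl ⟨rfl, rfl⟩⟩

/-- The bipartition of the double wheel. -/
def coloring (m : ℕ) : (graph m).Coloring Bool :=
  SimpleGraph.Coloring.mk color <| by
    rintro x y ⟨a, ⟨rfl, rfl⟩ | ⟨rfl, rfl⟩⟩ <;> rw [a.color_tgt] <;> simp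

/-- The vertices of the double wheel, ring by ring. -/
def equivSum (m : ℕ) : DoubleWheel m ≃
    (Bool ⊕ Bool × (ZMod m × Bool)) ⊕ (Bool × ZMod m ⊕ ZMod m × Bool) where
  toFun
    | hub s => .inl (.inl s)
    | inner s i => .inr (.inl (s, i))
    | outer s p => .inl (.inr (s, p))
    | mid p => .inr (.inr p)
  invFun
    | .inl (.inl s) => hub s
    | .inr (.inl (s, i)) => inner s i
    | .inl (.inr (s, p)) => outer s p
    | .inr (.inr p) => mid p
  left_inv := by rintro (_ | _ | _ | _) <;> rfl
  right_inv := by rintro ((_ | ⟨_, _⟩) | (⟨_, _⟩ | _)) <;> rfl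

/-! ### Counting vertices ring by ring -/

open Classical in
/-- The number of elements of `T` on a ring. -/
noncomputable def ringCard {ι : Type*} [Fintype ι] (T : Set (DoubleWheel m))
    (f : ι → DoubleWheel m) : ℕ :=
  (Finset.univ.filter fun i => f i ∈ T).card

theorem ringCard_add_add {ι : Type*} [Fintype ι] {A B S : Set (DoubleWheel m)}
    (hAB : Disjoint A B) (hAS : Disjoint A S) (hBS : Disjoint B S) (h : ∀ v, v ∈ A ∨ v ∈ B ∨ v ∈ S)
    (f : ι → DoubleWheel m) :
    ringCard A f + ringCard B f + ringCard S f = Fintype.card ι := by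
  classical
  rw [ringCard, ringCard, ringCard, ← Finset.card_union_of_disjoint,
    ← Finset.card_union_of_disjoint, ← Finset.card_univ]
  · congr 1
    ext i
    simpa [or_assoc] using h (f i)
  · rw [Finset.disjoint_union_left]
    simp only [Finset.disjoint_filter]
    exact ⟨fun i _ h1 h2 => Set.disjoint_left.1 hAS h1 h2,
      fun i _ h1 h2 => Set.disjoint_left.1 hBS h1 h2⟩
  · simp only [Finset.disjoint_filter]
    exact fun i _ h1 h2 => Set.disjoint_left.1 hAB h1 h2

theorem ringCard_pos {ι : Type*} [Fintype ι] {A : Set (DoubleWheel m)} {f : ι → DoubleWheel m}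
    {i : ι} (h : f i ∈ A) : 0 < ringCard A f :=
  Finset.card_pos.2 ⟨i, by simpa using h⟩

/-- The set `A` has no neighbour outside `A ∪ S`. -/
def IsClosedUpTo (A S : Set (DoubleWheel m)) : Prop :=
  ∀ x ∈ A, ∀ y, (graph m).Adj x y → y ∈ A ∪ S

theorem card_le_ringCard_add_ringCard {ι : Type*} [Fintype ι] [DecidableEq ι]
    {A S : Set (DoubleWheel m)} {f : ι → DoubleWheel m} {X : Finset ι}
    (h : ∀ i ∈ X, f i ∈ A ∪ S) : X.card ≤ ringCard A f + ringCard S f := by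
  classical
  rw [ringCard, ringCard]
  refine (Finset.card_le_card fun i hi => ?_).trans (Finset.card_union_le _ _)
  simpa using h i hi

/-- The neighbours of an outer vertex. -/
theorem exists_neighbors_outer (hm : 10 ≤ m) : ∃ N : Finset (DoubleWheel m),
    (∀ x, x ∈ N ↔ (graph m).Adj (outer true (0, false)) x) ∧ N.card = 5 := by
  classical
  have h1 : (1 : ZMod m) ≠ 0 := by
    have : Fact (1 < m) := ⟨by omega⟩
    exact one_ne_zero
  have hf : ∀ (i : ZMod m) (d : Fin 4), fanEnd i d = (0, false) ↔ (i = 0 ∧ d = 1) ∨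
      (i = -1 ∧ d = 3) := by
    intro i d
    fin_cases d <;> simp [fanEnd, eq_neg_iff_add_eq_zero]
  refine ⟨{inner true 0, inner true (-1), mid (-1, true), mid (0, false), mid (0, true)}, ?_, ?_⟩
  · intro x
    simp only [Finset.mem_insert, Finset.mem_singleton]
    constructor
    · rintro (rfl | rfl | rfl | rfl | rfl)
      · exact ⟨.fan true 0 1, Or.inr ⟨rfl, rfl⟩⟩
      · refine ⟨.fan true (-1) 3, Or.inr ⟨rfl, ?_⟩⟩
        simp [Arrow.tgt, fanEnd]
      · refine ⟨.link true (0, false) 0, Or.inl ⟨rfl, ?_⟩⟩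
        simp [Arrow.tgt, linkEnd]
      · exact ⟨.link true (0, false) 1, Or.inl ⟨rfl, rfl⟩⟩
      · exact ⟨.link true (0, false) 2, Or.inl ⟨rfl, rfl⟩⟩
    · rintro ⟨_ | ⟨s, i, d⟩ | ⟨s, p, d⟩, ⟨h, rfl⟩ | ⟨rfl, h⟩⟩ <;> simp [Arrow.src, Arrow.tgt] at h
      · obtain ⟨rfl, h⟩ := h
        rcases (hf i d).1 h with ⟨rfl, rfl⟩ | ⟨rfl, rfl⟩ <;> simp [Arrow.src]
      · obtain ⟨rfl, rfl⟩ := h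
        fin_cases d <;> simp [Arrow.tgt, linkEnd]
  · simp [h1]

/-- A nonempty set grows under a transitive permutation, unless it is everything. -/
theorem card_union_map_ge {α : Type*} [Fintype α] [DecidableEq α] (σ : Equiv.Perm α)
    (hσ : ∀ X : Finset α, X.Nonempty → (∀ x ∈ X, σ x ∈ X) → X = Finset.univ)
    {X : Finset α} (hX : X.Nonempty) :
    min (Fintype.card α) (X.card + 1) ≤ (X ∪ X.map σ.toEmbedding).card := by
  by_cases h : ∀ x ∈ X, σ x ∈ X
  · rw [hσ X hX h, Finset.union_eq_left.2 (Finset.subset_univ _), Finset.card_univ]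
    exact min_le_left _ _
  · push Not at h
    obtain ⟨x, hx, hσx⟩ := h
    refine (min_le_right _ _).trans (Nat.succ_le_of_lt (Finset.card_lt_card ?_))
    refine Finset.ssubset_iff_of_subset Finset.subset_union_left |>.2 ⟨σ x, ?_, hσx⟩
    exact Finset.mem_union_right _ (Finset.mem_map_of_mem _ hx)

/-- By finiteness, a set closed under the inverse permutation is mapped onto itself, hence also
closed under the permutation. -/
theorem symm_transitive {α : Type*} [Fintype α] [DecidableEq α] {σ : Equiv.Perm α}
    (hσ : ∀ X : Finset α, X.Nonempty → (∀ x ∈ X, σ x ∈ X) → X = Finset.univ)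
    (X : Finset α) (hX : X.Nonempty) (h : ∀ x ∈ X, σ.symm x ∈ X) : X = Finset.univ := by
  refine hσ X hX fun x hx => ?_
  have hmap : X.map σ.symm.toEmbedding = X :=
    Finset.map_eq_of_subset fun y hy => by
      obtain ⟨z, hz, rfl⟩ := Finset.mem_map.1 hy
      exact h z hz
  rw [← hmap] at hx
  obtain ⟨z, hz, rfl⟩ := Finset.mem_map.1 hx
  simpa using hz

variable [NeZero m]

instance : Fintype (DoubleWheel m) := Fintype.ofEquiv _ (equivSum m).symm

theorem card_eq : Fintype.card (DoubleWheel m) = 8 * m + 2 := by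
  rw [Fintype.card_congr (equivSum m)]
  simp only [Fintype.card_sum, Fintype.card_prod, Fintype.card_bool, ZMod.card]
  ring

theorem sum_eq (f : DoubleWheel m → ℕ) :
    ∑ v, f v = (f (hub true) + f (hub false)) +
      (∑ i, f (inner true i) + ∑ i, f (inner false i)) +
      (∑ p, f (outer true p) + ∑ p, f (outer false p)) + ∑ p, f (mid p) := by
  rw [Fintype.sum_equiv (equivSum m) f (f ∘ (equivSum m).symm) (by simp)]
  rw [Fintype.sum_sum_type, Fintype.sum_sum_type, Fintype.sum_sum_type,
    Fintype.sum_prod_type, Fintype.sum_prod_type, Fintype.sum_bool, Fintype.sum_bool,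
    Fintype.sum_bool]
  simp only [Function.comp, equivSum, Equiv.coe_fn_symm_mk]
  ring

/-- The surplus of two, due to the hubs, is what rules out a Hamiltonian cycle. -/
theorem card_color (b : Bool) :
    Fintype.card {v : DoubleWheel m // color v = b} = if b then 4 * m + 2 else 4 * m := by
  rw [Fintype.card_subtype, Finset.card_filter, sum_eq]
  cases b <;> simp [color, ZMod.card] <;> ring

theorem card_eq_sum_ringCard (S : Finset (DoubleWheel m)) :
    S.card = (ringCard (S : Set (DoubleWheel m)) (fun _ : Unit => hub true) +
        ringCard (S : Set (DoubleWheel m)) (fun _ : Unit => hub false)) +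
      (ringCard (S : Set (DoubleWheel m)) (inner true) +
        ringCard (S : Set (DoubleWheel m)) (inner false)) +
      (ringCard (S : Set (DoubleWheel m)) (outer true) +
        ringCard (S : Set (DoubleWheel m)) (outer false)) +
      ringCard (S : Set (DoubleWheel m)) mid := by
  classical
  have h : S.card = ∑ v, if v ∈ S then 1 else 0 := by
    rw [← Finset.card_filter, Finset.filter_univ_mem]
  rw [h, sum_eq]
  simp only [ringCard, Finset.card_filter, Finset.mem_coe, Fintype.sum_unique]

theorem zmod_closed_mem {P : ZMod m → Prop} {i : ZMod m} (hi : P i)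
    (h : ∀ i, P i → P (i + 1)) (j : ZMod m) : P j := by
  have key : ∀ n : ℕ, P (i + n) := by
    intro n
    induction n with
    | zero => simpa using hi
    | succ n ih => rw [Nat.cast_succ, ← add_assoc]; exact h _ ih
  have := key (j - i).val
  rwa [ZMod.natCast_val, ZMod.cast_id, add_sub_cancel] at this

theorem addRight_transitive (X : Finset (ZMod m)) (hX : X.Nonempty)
    (h : ∀ x ∈ X, Equiv.addRight (1 : ZMod m) x ∈ X) : X = Finset.univ := by
  obtain ⟨i, hi⟩ := hX
  exact Finset.eq_univ_of_forall (zmod_closed_mem (P := (· ∈ X)) hi h)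

/-- Two steps of `next` shift the `ZMod m` coordinate by one. -/
theorem next_transitive (X : Finset (ZMod m × Bool)) (hX : X.Nonempty)
    (h : ∀ x ∈ X, next x ∈ X) : X = Finset.univ := by
  obtain ⟨i, hi⟩ : ∃ i, (i, true) ∈ X := by
    obtain ⟨⟨i, _ | _⟩, hi⟩ := hX
    · exact ⟨i, h _ hi⟩
    · exact ⟨i, hi⟩
  have htrue : ∀ j, (j, true) ∈ X :=
    zmod_closed_mem (P := fun j => (j, true) ∈ X) hi fun j hj => h _ (h _ hj)
  refine Finset.eq_univ_of_forall ?_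
  rintro ⟨j, _ | _⟩
  · have := h _ (htrue (j - 1))
    rwa [next_true, sub_add_cancel] at this
  · exact htrue j

/-! ### Expansion from each ring to the next -/

theorem IsClosedUpTo.hub_le {A S : Set (DoubleWheel m)} (h : IsClosedUpTo A S) (s : Bool)
    (hpos : 0 < ringCard A (fun _ : Unit => hub s)) :
    m ≤ ringCard A (inner s) + ringCard S (inner s) := by
  classical
  obtain ⟨_, hs⟩ := Finset.card_pos.1 hpos
  replace hs : hub s ∈ A := (Finset.mem_filter.1 hs).2
  have := card_le_ringCard_add_ringCard (f := inner s) (X := Finset.univ)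
    fun i _ => h _ hs _ (Arrow.spoke s i).adj
  rwa [Finset.card_univ, ZMod.card] at this

/-- If `X` is the part of `A` on the inner ring, its outer neighbours are `X ∪ (X + 1)` with flag
`false` and `X ∪ (X - 1)` with flag `true`. Each union exceeds `X` by at least one unless it is the
whole ring. -/
theorem IsClosedUpTo.inner_le {A S : Set (DoubleWheel m)} (h : IsClosedUpTo A S) (s : Bool)
    (hpos : 0 < ringCard A (inner s)) :
    min (2 * m) (2 * ringCard A (inner s) + 2) ≤
      ringCard A (outer s) + ringCard S (outer s) := by
  classical
  set X := Finset.univ.filter fun i => inner s i ∈ A with hXdef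
  have hX : X.Nonempty := Finset.card_pos.1 hpos
  have hXc : ringCard A (inner s) = X.card := rfl
  have hmem : ∀ i, i ∈ X → ∀ d, outer s (fanEnd i d) ∈ A ∪ S := fun i hi d =>
    h _ (Finset.mem_filter.1 hi).2 _ (Arrow.fan s i d).adj
  have h1 := card_union_map_ge _ addRight_transitive hX
  have h2 := card_union_map_ge _ (symm_transitive addRight_transitive) hX
  set X1 := X ∪ X.map (Equiv.addRight (1 : ZMod m)).toEmbedding with hX1
  set X2 := X ∪ X.map (Equiv.addRight (1 : ZMod m)).symm.toEmbedding with hX2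
  have h3 := card_le_ringCard_add_ringCard (A := A) (S := S) (f := outer s)
    (X := X1 ×ˢ {false} ∪ X2 ×ˢ {true}) (by
      rintro ⟨i, b⟩ hi
      simp only [Finset.mem_union, Finset.mem_product, Finset.mem_singleton, hX1, hX2,
        Finset.mem_map_equiv] at hi
      rcases hi with ⟨hi | hi, rfl⟩ | ⟨hi | hi, rfl⟩
      · exact hmem i hi 1
      · simpa [fanEnd] using hmem _ hi 3
      · exact hmem i hi 2
      · simpa [fanEnd] using hmem _ hi 0)
  rw [Finset.card_union_of_disjoint, Finset.card_product, Finset.card_product,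
    Finset.card_singleton, Finset.card_singleton] at h3
  · rw [ZMod.card] at h1 h2
    omega
  · rw [Finset.disjoint_left]
    rintro ⟨i, b⟩ hi hi'
    simp only [Finset.mem_product, Finset.mem_singleton] at hi hi'
    exact Bool.false_ne_true (hi.2.symm.trans hi'.2)

/-- The middle neighbours of `X` are its translates by `-1`, `0` and `1`. They arise from two
successive enlargements, each gaining at least one element until the ring is full. -/
theorem IsClosedUpTo.outer_le {A S : Set (DoubleWheel m)} (h : IsClosedUpTo A S) (s : Bool)
    (hpos : 0 < ringCard A (outer s)) :
    min (2 * m) (ringCard A (outer s) + 2) ≤ ringCard A mid + ringCard S mid := by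
  classical
  set X := Finset.univ.filter fun i => outer s i ∈ A with hXdef
  have hX : X.Nonempty := Finset.card_pos.1 hpos
  have hXc : ringCard A (outer s) = X.card := rfl
  have hmem : ∀ i, i ∈ X → ∀ d, mid (linkEnd i d) ∈ A ∪ S := fun i hi d =>
    h _ (Finset.mem_filter.1 hi).2 _ (Arrow.link s i d).adj
  have h1 := card_union_map_ge _ next_transitive hX
  set Y := X ∪ X.map (next (m := m)).toEmbedding with hY
  have h2 := card_union_map_ge _ (symm_transitive next_transitive)
    (hX.mono Finset.subset_union_left : Y.Nonempty)
  have h3 := card_le_ringCard_add_ringCard (A := A) (S := S) (f := mid)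
    (X := Y ∪ Y.map (next (m := m)).symm.toEmbedding) (by
      intro i hi
      simp only [Finset.mem_union, hY, Finset.mem_map_equiv, Equiv.symm_symm,
        Equiv.symm_apply_apply] at hi
      rcases hi with (hi | hi) | (hi | hi)
      · exact hmem i hi 1
      · simpa [linkEnd] using hmem _ hi 2
      · simpa [linkEnd] using hmem _ hi 0
      · exact hmem i hi 1)
  rw [Fintype.card_prod, ZMod.card, Fintype.card_bool] at h1 h2
  omega

/-- Split the complement of `S` into the component `A` of `u` and the rest `B`. Both are closed up
to `S`, so the expansion bounds turn the claim into linear arithmetic in the ring counts. -/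
theorem not_isSeparator (hm : 10 ≤ m) (S : Finset (DoubleWheel m)) (hS : S.card ≤ 4) :
    ¬ (graph m).IsSeparator S := by
  intro hsep
  simp only [SimpleGraph.IsSeparator, SimpleGraph.Preconnected, not_forall] at hsep
  obtain ⟨u, v, huv⟩ := hsep
  set R := (graph m).induce {v | v ∉ S}
  let A : Set (DoubleWheel m) := {x | ∃ h : x ∉ S, R.Reachable u ⟨x, h⟩}
  let B : Set (DoubleWheel m) := {x | ∃ h : x ∉ S, ¬ R.Reachable u ⟨x, h⟩}
  have huA : u.1 ∈ A := ⟨u.2, SimpleGraph.Reachable.refl _⟩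
  have hvB : v.1 ∈ B := ⟨v.2, huv⟩
  have hA : IsClosedUpTo A S := by
    rintro x ⟨hx, hr⟩ y hxy
    by_cases hy : y ∈ S
    · exact Or.inr hy
    · exact Or.inl ⟨hy, hr.trans (SimpleGraph.Adj.reachable (G := R) (u := ⟨x, hx⟩) hxy)⟩
  have hB : IsClosedUpTo B S := by
    rintro x ⟨hx, hr⟩ y hxy
    by_cases hy : y ∈ S
    · exact Or.inr hy
    · exact Or.inl ⟨hy, fun hr' => hr (hr'.trans
        (SimpleGraph.Adj.reachable (G := R) (u := ⟨y, hy⟩) (v := ⟨x, hx⟩) hxy.symm))⟩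
  have total : ∀ {ι : Type} [Fintype ι] (f : ι → DoubleWheel m),
      ringCard A f + ringCard B f + ringCard (S : Set (DoubleWheel m)) f = Fintype.card ι := by
    intro ι _ f
    refine ringCard_add_add ?_ ?_ ?_ (fun x => ?_) f
    · exact Set.disjoint_left.2 fun x ⟨h, h1⟩ ⟨_, h2⟩ => h2 h1
    · exact Set.disjoint_left.2 fun x ⟨h, _⟩ h2 => h h2
    · exact Set.disjoint_left.2 fun x ⟨h, _⟩ h2 => h h2
    · by_cases hx : x ∈ S
      · exact Or.inr (Or.inr hx)
      · by_cases hr : R.Reachable u ⟨x, hx⟩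
        · exact Or.inl ⟨hx, hr⟩
        · exact Or.inr (Or.inl ⟨hx, hr⟩)
  have th := fun s : Bool => total (fun _ : Unit => (hub s : DoubleWheel m))
  have tI := fun s : Bool => total (inner (m := m) s)
  have tO := fun s : Bool => total (outer (m := m) s)
  have tM := total (mid (m := m))
  simp only [Fintype.card_prod, ZMod.card, Fintype.card_bool, Fintype.card_unit] at th tI tO tM
  rw [card_eq_sum_ringCard] at hS
  have pos : ∀ {T : Set (DoubleWheel m)} {x : DoubleWheel m}, x ∈ T →
      ∃ s, 0 < ringCard T (fun _ : Unit => (hub s : DoubleWheel m)) ∨ 0 < ringCard T (inner s) ∨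
        0 < ringCard T (outer s) ∨ 0 < ringCard T mid := by
    rintro T (s | ⟨s, i⟩ | ⟨s, p⟩ | p) hx
    · exact ⟨s, Or.inl (ringCard_pos (i := ()) hx)⟩
    · exact ⟨s, Or.inr (Or.inl (ringCard_pos hx))⟩
    · exact ⟨s, Or.inr (Or.inr (Or.inl (ringCard_pos hx)))⟩
    · exact ⟨true, Or.inr (Or.inr (Or.inr (ringCard_pos hx)))⟩
  have hS' : ∀ s, ringCard (S : Set (DoubleWheel m)) (fun _ : Unit => hub s) +
      ringCard (S : Set (DoubleWheel m)) (inner s) +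
      ringCard (S : Set (DoubleWheel m)) (outer s) +
      ringCard (S : Set (DoubleWheel m)) mid ≤ 4 := by
    rintro (_ | _) <;> omega
  -- If both parts meet the outer ring, adding their expansion bounds puts all four vertices of `S`
  -- on the outer and middle rings. The hub then pulls the whole inner ring, hence the whole outer
  -- ring up to `S`, into its own part, a contradiction. If only one part meets the outer ring, it
  -- misses at least three outer vertices, which lie in `S`.
  have mixed : 0 < ringCard A mid → 0 < ringCard B mid →
      ∀ s, 3 ≤ ringCard (S : Set (DoubleWheel m)) (outer s) := by
    intro haM hbM s
    have := hS' s
    have := tI s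
    have := tO s
    have := hA.inner_le s
    have := hB.inner_le s
    have := hA.outer_le s
    have := hB.outer_le s
    have := th s
    have := hA.hub_le s
    have := hB.hub_le s
    omega
  -- A part missing the middle ring has its middle neighbours in `S`, so it is small; the bounds for
  -- both parts then force a fifth vertex into `S`.
  have unmixed : ∀ {A B : Set (DoubleWheel m)}, IsClosedUpTo A S → IsClosedUpTo B S →
      (∀ {ι : Type} [Fintype ι] (f : ι → DoubleWheel m),
        ringCard A f + ringCard B f + ringCard (S : Set (DoubleWheel m)) f = Fintype.card ι) →
      (∃ x, x ∈ B) → ringCard B mid ≠ 0 := by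
    rintro A B hA hB total ⟨x, hx⟩ hbM
    obtain ⟨s, hs⟩ := pos hx
    have th := total (fun _ : Unit => (hub s : DoubleWheel m))
    have tI := total (inner (m := m) s)
    have tO := total (outer (m := m) s)
    have tM := total (mid (m := m))
    simp only [Fintype.card_prod, ZMod.card, Fintype.card_bool, Fintype.card_unit] at th tI tO tM
    have := hS' s
    have := hA.inner_le s
    have := hB.inner_le s
    have := hA.outer_le s
    have := hB.outer_le s
    have := hA.hub_le s
    have := hB.hub_le s
    omega
  have hbM := unmixed hA hB total ⟨_, hvB⟩
  have haM := unmixed hB hA (fun f => by rw [← total f]; ring) ⟨_, huA⟩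
  have h1 := mixed (Nat.pos_of_ne_zero haM) (Nat.pos_of_ne_zero hbM) true
  have h2 := mixed (Nat.pos_of_ne_zero haM) (Nat.pos_of_ne_zero hbM) false
  -- Three outer vertices of `S` on each side make six.
  omega

end DoubleWheel

open Complex ComplexConjugate

namespace DoubleWheel

/-! ### The Cayley transform of the unit disc -/

/-- The Cayley transform, which maps the unit disc to the upper half-plane. -/
noncomputable def cayley (z : ℂ) : ℂ := I * (1 + z) / (1 - z)

theorem cayley_injOn : Set.InjOn cayley {z | z ≠ 1} := by
  intro z hz w hw h
  have hz' : 1 - z ≠ 0 := sub_ne_zero.2 (Ne.symm hz)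
  have hw' : 1 - w ≠ 0 := sub_ne_zero.2 (Ne.symm hw)
  rw [cayley, cayley, div_eq_div_iff hz' hw', mul_assoc, mul_assoc] at h
  have := mul_left_cancel₀ I_ne_zero h
  linear_combination this / 2

theorem im_cayley (z : ℂ) : (cayley z).im = (1 - normSq z) / normSq (1 - z) := by
  rw [cayley, div_im, normSq_apply z]
  simp only [mul_re, mul_im, I_re, I_im, add_re, add_im, sub_re, sub_im, one_re, one_im]
  ring

theorem im_cayley_pos {z : ℂ} (hz : ‖z‖ < 1) : 0 < (cayley z).im := by
  rw [im_cayley]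
  have h1 : normSq z < 1 := by
    rw [normSq_eq_norm_sq]
    nlinarith [norm_nonneg z]
  refine div_pos (by linarith) (normSq_pos.2 (sub_ne_zero.2 ?_))
  rintro rfl
  simp at hz

/-- This includes the pole `z = 1`, where division by zero gives the value `0`. -/
theorem im_cayley_of_norm_eq_one {z : ℂ} (hz : ‖z‖ = 1) : (cayley z).im = 0 := by
  rw [im_cayley, normSq_eq_norm_sq, hz]
  simp

/-- Two copies of the unit disc, mapped to the upper and to the lower half-plane. -/
noncomputable def half (s : Bool) (z : ℂ) : ℂ := if s then cayley z else conj (cayley z)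

theorem half_eq_of_norm_eq_one {z : ℂ} (hz : ‖z‖ = 1) (s : Bool) : half s z = cayley z := by
  cases s
  · exact conj_eq_iff_im.2 (im_cayley_of_norm_eq_one hz)
  · rfl

theorem half_injOn (s : Bool) : Set.InjOn (half s) {z | z ≠ 1} := by
  cases s
  · exact fun z hz w hw h => cayley_injOn hz hw ((starRingEnd ℂ).injective h)
  · exact cayley_injOn

theorem im_half_pos_iff {z : ℂ} (hz : ‖z‖ < 1) (s : Bool) : 0 < (half s z).im ↔ s = true := by
  have := im_cayley_pos hz
  cases s
  · simp [half, this.le]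
  · simp [half, this]

theorem half_eq_half {s s' : Bool} {z w : ℂ} (hz : ‖z‖ < 1) (hw : ‖w‖ < 1)
    (h : half s z = half s' w) : s = s' ∧ z = w := by
  have h1 := im_half_pos_iff hz s
  rw [h, im_half_pos_iff hw] at h1
  have hs : s = s' := Bool.eq_iff_iff.2 h1.symm
  refine ⟨hs, half_injOn s ?_ ?_ (hs ▸ h)⟩ <;> rintro rfl <;> simp at hz hw

/-- Open discs go off the real axis and the unit circle goes into it, so the two cases cannot mix.
Thus the radius can be read off in the plane, whichever side a point comes from. -/
theorem norm_eq_of_half_eq_half {s s' : Bool} {z w : ℂ} (hz : ‖z‖ ≤ 1) (hw : ‖w‖ ≤ 1)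
    (h : half s z = half s' w) : ‖z‖ = ‖w‖ := by
  have key : ∀ {s s' : Bool} {z w : ℂ}, ‖z‖ < 1 → ‖w‖ = 1 → half s z ≠ half s' w := by
    intro s s' z w hz hw h
    have h1 : (half s z).im = 0 := by
      rw [h, half_eq_of_norm_eq_one hw, im_cayley_of_norm_eq_one hw]
    have h2 := im_cayley_pos hz
    cases s
    · simp [half] at h1
      linarith
    · simp [half] at h1
      linarith
  rcases hz.lt_or_eq with hz | hz <;> rcases hw.lt_or_eq with hw | hw
  · rw [(half_eq_half hz hw h).2]
  · exact absurd h (key hz hw)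
  · exact absurd h.symm (key hw hz)
  · rw [hz, hw]

theorem continuousOn_half (s : Bool) : ContinuousOn (half s) {z | z ≠ 1} := by
  have h : ContinuousOn cayley {z | z ≠ 1} :=
    ContinuousOn.div (by fun_prop) (by fun_prop) fun z hz => sub_ne_zero.2 (Ne.symm hz)
  cases s
  · exact continuous_conj.comp_continuousOn h
  · exact h

/-! ### Polar coordinates -/

variable {m : ℕ}

/-- The point of the unit circle at the angle `x`, where `2 * m` is a full turn. -/
noncomputable def turn (m : ℕ) (x : ℝ) : ℂ := exp ((Real.pi * x / m : ℝ) * I)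

theorem norm_turn (x : ℝ) : ‖turn m x‖ = 1 := norm_exp_ofReal_mul_I _

theorem continuous_turn : Continuous (turn m) := by
  unfold turn
  fun_prop

theorem norm_mul_turn {r : ℝ} (hr : 0 ≤ r) (x : ℝ) : ‖(r : ℂ) * turn m x‖ = r := by
  rw [norm_mul, norm_turn, mul_one, norm_real, Real.norm_of_nonneg hr]

variable [NeZero m]

theorem turn_eq_turn_iff {x y : ℝ} : turn m x = turn m y ↔ ∃ n : ℤ, x = y + 2 * m * n := by
  have hm : (m : ℝ) ≠ 0 := Nat.cast_ne_zero.2 (NeZero.ne m)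
  rw [turn, turn, exp_eq_exp_iff_exists_int]
  refine exists_congr fun n => ?_
  have h : (2 * Real.pi * I : ℂ) = (2 * Real.pi : ℝ) * I := by push_cast; ring
  have h' : ((Real.pi * y / m : ℝ) : ℂ) * I + n * (2 * Real.pi * I) =
      ((Real.pi * y / m + n * (2 * Real.pi) : ℝ) : ℂ) * I := by push_cast; ring
  rw [h', mul_left_inj' I_ne_zero, ofReal_inj, div_eq_iff hm, add_mul, div_mul_cancel₀ _ hm]
  constructor
  · intro h
    exact mul_left_cancel₀ Real.pi_ne_zero (by linear_combination h)
  · rintro rfl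
    ring

/-- The integer position of an element of a ring of `2 * m` elements. -/
def position (p : ZMod m × Bool) : ℤ := 2 * (p.1.val : ℤ) + if p.2 then 1 else 0

theorem exists_val_eq {i : ZMod m} {a : ℤ} (h : i = (a : ZMod m)) :
    ∃ n : ℤ, (i.val : ℤ) = a + m * n := by
  have : ((i.val : ℤ) : ZMod m) = (a : ZMod m) := by
    rw [Int.cast_natCast, ZMod.natCast_val, ZMod.cast_id]
    exact h
  obtain ⟨n, hn⟩ := (ZMod.intCast_eq_intCast_iff_dvd_sub _ _ _).1 this.symm
  exact ⟨n, by linarith⟩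

theorem eq_of_val_eq {i j : ZMod m} {a n : ℤ} (h : (i.val : ℤ) = j.val + a + m * n) :
    i = j + a := by
  have := congrArg (Int.cast : ℤ → ZMod m) h
  simpa using this

theorem exists_position_next (p : ZMod m × Bool) :
    ∃ n : ℤ, position (next p) = position p + 1 + 2 * m * n := by
  obtain ⟨i, _ | _⟩ := p
  · exact ⟨0, by simp [position]⟩
  · obtain ⟨n, hn⟩ := exists_val_eq (i := i + 1) (a := i.val + 1) (by simp)
    exact ⟨n, by simp [position, hn]; ring⟩

theorem exists_position_next_symm (p : ZMod m × Bool) :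
    ∃ n : ℤ, position (next.symm p) = position p - 1 + 2 * m * n := by
  obtain ⟨n, hn⟩ := exists_position_next (next.symm p)
  rw [Equiv.apply_symm_apply] at hn
  exact ⟨-n, by linarith⟩

theorem eq_of_position_eq {p q : ZMod m × Bool} {n : ℤ}
    (h : position p = position q + 2 * m * n) : p = q := by
  obtain ⟨i, b⟩ := p
  obtain ⟨j, c⟩ := q
  simp only [position] at h
  rw [mul_assoc] at h
  have hv : b = c ∧ (i.val : ℤ) = j.val + 0 + m * n := by
    -- With the product hidden, parity separates the flags `b` and `c` from the rest.
    generalize (m : ℤ) * n = k at h ⊢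
    cases b <;> cases c <;> simp at h ⊢ <;> omega
  have := eq_of_val_eq hv.2
  rw [Int.cast_zero, add_zero] at this
  rw [this, hv.1]

end DoubleWheel

namespace DoubleWheel

/-! ### The drawing: points and spirals -/

variable {m : ℕ}

/-- The side of a vertex; the middle ring belongs to both sides. -/
def side : DoubleWheel m → Bool
  | hub s => s
  | inner s _ => s
  | outer s _ => s
  | mid _ => true

/-- The ring of a vertex, counted from the hub. -/
def level : DoubleWheel m → ℕ
  | hub _ => 0
  | inner _ _ => 1
  | outer _ _ => 2
  | mid _ => 3

/-- The angle of a vertex, where `2 * m` is a full turn. -/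
noncomputable def angle : DoubleWheel m → ℝ
  | hub _ => 0
  | inner _ i => 2 * i.val + 1
  | outer _ p => position p + 1 / 2
  | mid p => position p + 1 / 2

/-- The point of the unit disc that represents a vertex. -/
noncomputable def discPoint (v : DoubleWheel m) : ℂ :=
  ((level v / 3 : ℝ) : ℂ) * turn m (angle v)

/-- The point of the plane that represents a vertex. -/
noncomputable def point (v : DoubleWheel m) : ℂ := half (side v) (discPoint v)

namespace Arrow

/-- The side of an edge. -/
def side : Arrow m → Bool
  | spoke s _ => s
  | fan s _ _ => s
  | link s _ _ => s

/-- The ring at which an edge starts. -/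
def level : Arrow m → ℕ
  | spoke _ _ => 0
  | fan _ _ _ => 1
  | link _ _ _ => 2

/-- The angle at which an edge starts. -/
noncomputable def start : Arrow m → ℝ
  | spoke _ i => 2 * i.val + 1
  | fan _ i _ => 2 * i.val + 1
  | link _ p _ => position p + 1 / 2

/-- The angle that is swept by an edge. -/
noncomputable def slope : Arrow m → ℝ
  | spoke _ _ => 0
  | fan _ _ d => d.val - 3 / 2
  | link _ _ d => d.val - 1

/-- The arc of an edge in the unit disc: radius and angle change at constant speed. -/
noncomputable def disc (a : Arrow m) (t : ℝ) : ℂ :=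
  (((a.level + t) / 3 : ℝ) : ℂ) * turn m (a.start + a.slope * t)

/-- The arc of an edge in the plane. -/
noncomputable def curve (a : Arrow m) (t : ℝ) : ℂ := half a.side (a.disc t)

theorem level_le (a : Arrow m) : (a.level : ℝ) ≤ 2 := by
  cases a <;> norm_num [level]

theorem norm_disc (a : Arrow m) {t : ℝ} (ht : 0 ≤ t) : ‖a.disc t‖ = (a.level + t) / 3 :=
  norm_mul_turn (by positivity) _

theorem norm_disc_le (a : Arrow m) {t : ℝ} (ht : 0 ≤ t) (ht1 : t ≤ 1) : ‖a.disc t‖ ≤ 1 := by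
  rw [a.norm_disc ht]
  linarith [a.level_le]

theorem norm_disc_lt (a : Arrow m) {t : ℝ} (ht : 0 ≤ t) (ht1 : t < 1) : ‖a.disc t‖ < 1 := by
  rw [a.norm_disc ht]
  linarith [a.level_le]

/-- The only edge that may cross a given edge. -/
def mate : Arrow m → Arrow m
  | spoke s i => spoke s i
  | fan s i d => if d = 3 then fan s (i + 1) 0 else fan s (i - 1) 3
  | link s p d => if d = 2 then link s (next p) 0 else link s (next.symm p) 2

/-- The time of the only possible crossing on an edge. -/
noncomputable def crossTime : Arrow m → ℝ
  | spoke _ _ => 0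
  | fan _ _ _ => 2 / 3
  | link _ _ _ => 1 / 2

end Arrow

theorem level_le (v : DoubleWheel m) : level v ≤ 3 := by
  cases v <;> simp [level]

theorem norm_discPoint (v : DoubleWheel m) : ‖discPoint v‖ = level v / 3 :=
  norm_mul_turn (by positivity) _

theorem norm_discPoint_le (v : DoubleWheel m) : ‖discPoint v‖ ≤ 1 := by
  rw [norm_discPoint]
  have : (level v : ℝ) ≤ 3 := by exact_mod_cast level_le v
  linarith

theorem exists_arrow (e : (graph m).edgeSet) : ∃ a : Arrow m, s(a.src, a.tgt) = e.1 := by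
  obtain ⟨e, he⟩ := e
  induction e with
  | _ x y =>
    obtain ⟨a, ⟨h1, h2⟩ | ⟨h1, h2⟩⟩ := he
    · exact ⟨a, congrArg₂ (fun u v => s(u, v)) h1 h2⟩
    · exact ⟨a, (congrArg₂ (fun u v => s(u, v)) h1 h2).trans Sym2.eq_swap⟩

theorem half_integer_ne (k n : ℤ) : (k : ℝ) + 1 / 2 ≠ 2 * m * n := by
  intro h
  have : (2 * k + 1 : ℤ) = 2 * (2 * m * n) := by
    have : ((2 * k + 1 : ℤ) : ℝ) = ((2 * (2 * m * n) : ℤ) : ℝ) := by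
      push_cast
      linarith
    exact_mod_cast this
  omega

variable [NeZero m]

/-- The shift by `1 / 2` in `angle` keeps the middle vertices away from the pole of the Cayley
transform. -/
theorem turn_half_integer_ne_one (k : ℤ) : turn m (k + 1 / 2) ≠ 1 := by
  intro h
  have h0 : turn m 0 = 1 := by simp [turn]
  rw [← h0, turn_eq_turn_iff] at h
  obtain ⟨n, hn⟩ := h
  exact half_integer_ne (m := m) k n (by linarith)

theorem position_eq_of_turn_eq {p q : ZMod m × Bool} {a : ℤ}
    (h : turn m (position p + 1 / 2) = turn m (position q + 1 / 2 + a)) :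
    ∃ n : ℤ, position p = position q + a + 2 * m * n := by
  obtain ⟨n, hn⟩ := turn_eq_turn_iff.1 h
  refine ⟨n, ?_⟩
  have : (position p : ℝ) = ((position q + a + 2 * m * n : ℤ) : ℝ) := by
    push_cast
    linarith
  exact_mod_cast this

theorem val_eq_of_eq {i j : ZMod m} {a n : ℤ}
    (h : (2 * i.val + 1 : ℝ) = 2 * j.val + 1 + 2 * a + 2 * m * n) : i = j + a := by
  refine eq_of_val_eq (n := n) ?_
  have : ((i.val : ℤ) : ℝ) = ((j.val + a + m * n : ℤ) : ℝ) := by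
    push_cast
    linarith
  exact_mod_cast this

theorem point_injective : Function.Injective (point (m := m)) := by
  intro v w h
  have hn := norm_eq_of_half_eq_half (norm_discPoint_le v) (norm_discPoint_le w) h
  rw [norm_discPoint, norm_discPoint] at hn
  have hl : level v = level w := by
    have : (level v : ℝ) = level w := by linarith
    exact_mod_cast this
  have hangle : 0 < level v → discPoint v = discPoint w → turn m (angle v) = turn m (angle w) := by
    intro hpos h
    rw [discPoint, discPoint, ← hl] at h
    refine mul_left_cancel₀ (ofReal_ne_zero.2 ?_) h
    have : (0 : ℝ) < level v := by exact_mod_cast hpos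
    positivity
  have hlt : level v < 3 → side v = side w ∧ discPoint v = discPoint w := by
    intro hlt
    have h3 : (level v : ℝ) < 3 := by exact_mod_cast hlt
    refine half_eq_half ?_ ?_ h
    · rw [norm_discPoint]
      linarith
    · rw [norm_discPoint, ← hl]
      linarith
  have hpos : ∀ p q : ZMod m × Bool,
      turn m (position p + 1 / 2) = turn m (position q + 1 / 2) → p = q := by
    intro p q hpq
    obtain ⟨n, hn⟩ := position_eq_of_turn_eq (p := p) (q := q) (a := 0) (by simpa using hpq)
    exact eq_of_position_eq (n := n) (by simpa using hn)
  cases v <;> cases w <;> simp [level] at hl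
  · have := (hlt (by simp [level])).1
    simpa [side] using this
  · obtain ⟨h1, h2⟩ := hlt (by simp [level])
    obtain ⟨n, hn⟩ := turn_eq_turn_iff.1 (hangle (by simp [level]) h2)
    have := val_eq_of_eq (a := 0) (n := n) (by simpa [angle, -ZMod.natCast_val] using hn)
    simp [side] at h1
    rw [h1, this, Int.cast_zero, add_zero]
  · obtain ⟨h1, h2⟩ := hlt (by simp [level])
    have := hpos _ _ (hangle (by simp [level]) h2)
    simp [side] at h1
    rw [h1, this]
  · have hne : ∀ p : ZMod m × Bool, discPoint (mid p) ≠ 1 := by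
      intro p hp
      refine turn_half_integer_ne_one (m := m) (position p) ?_
      rw [← hp, discPoint]
      simp [level, angle]
    have h2 := half_injOn true (hne _) (hne _) h
    have := hpos _ _ (hangle (by simp [level]) h2)
    rw [this]

/-! ### Arcs and their crossings -/

namespace Arrow

theorem disc_zero (a : Arrow m) : a.disc 0 = discPoint a.src := by
  cases a <;> simp [disc, discPoint, src, level, DoubleWheel.level, start, angle]

theorem turn_end (a : Arrow m) : turn m (a.start + a.slope) = turn m (angle a.tgt) := by
  rw [turn_eq_turn_iff]
  rcases a with ⟨s, i⟩ | ⟨s, i, d⟩ | ⟨s, p, d⟩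
  · exact ⟨0, by simp [start, slope, tgt, angle]⟩
  · fin_cases d
    · obtain ⟨n, hn⟩ := exists_val_eq (i := i - 1) (a := i.val - 1) (by simp)
      have hn : ((i - 1).val : ℝ) = i.val - 1 + m * n := by exact_mod_cast hn
      exact ⟨-n, by simp [start, slope, tgt, angle, fanEnd, position, hn, -ZMod.natCast_val]; ring⟩
    · exact ⟨0, by simp [start, slope, tgt, angle, fanEnd, position]; ring⟩
    · exact ⟨0, by simp [start, slope, tgt, angle, fanEnd, position]; ring⟩
    · obtain ⟨n, hn⟩ := exists_val_eq (i := i + 1) (a := i.val + 1) (by simp)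
      have hn : ((i + 1).val : ℝ) = i.val + 1 + m * n := by exact_mod_cast hn
      exact ⟨-n, by simp [start, slope, tgt, angle, fanEnd, position, hn, -ZMod.natCast_val]; ring⟩
  · fin_cases d
    · obtain ⟨n, hn⟩ := exists_position_next_symm p
      have hn : (position (next.symm p) : ℝ) = position p - 1 + 2 * m * n := by exact_mod_cast hn
      exact ⟨-n, by simp [start, slope, tgt, angle, linkEnd, hn]; ring⟩
    · exact ⟨0, by simp [start, slope, tgt, angle, linkEnd]⟩
    · obtain ⟨n, hn⟩ := exists_position_next p
      have hn : (position (next p) : ℝ) = position p + 1 + 2 * m * n := by exact_mod_cast hn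
      exact ⟨-n, by simp [start, slope, tgt, angle, linkEnd, hn]; ring⟩

theorem disc_one (a : Arrow m) : a.disc 1 = discPoint a.tgt := by
  have hl : (a.level + 1 : ℝ) = DoubleWheel.level a.tgt := by
    cases a <;> norm_num [level, tgt, DoubleWheel.level]
  rw [disc, discPoint, mul_one, a.turn_end, hl]

theorem curve_zero (a : Arrow m) : a.curve 0 = point a.src := by
  rw [curve, point, a.disc_zero]
  cases a <;> rfl

theorem curve_one (a : Arrow m) : a.curve 1 = point a.tgt := by
  rw [curve, point, a.disc_one]
  rcases a with _ | _ | ⟨s, p, d⟩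
  · rfl
  · rfl
  · have h : ‖discPoint (link s p d).tgt‖ = 1 := by
      rw [norm_discPoint]
      norm_num [tgt, DoubleWheel.level]
    rw [half_eq_of_norm_eq_one h, half_eq_of_norm_eq_one h]

theorem disc_ne_one (a : Arrow m) {t : ℝ} (ht : 0 ≤ t) (ht1 : t ≤ 1) : a.disc t ≠ 1 := by
  rcases ht1.lt_or_eq with h | rfl
  · intro h'
    have := a.norm_disc_lt ht h
    rw [h', norm_one] at this
    exact lt_irrefl _ this
  · rw [a.disc_one]
    rcases a with _ | _ | ⟨s, p, d⟩
    · intro h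
      have := norm_discPoint (spoke ‹_› ‹_› : Arrow m).tgt
      rw [h] at this
      norm_num [tgt, DoubleWheel.level] at this
    · intro h
      have := norm_discPoint (fan ‹_› ‹_› ‹_› : Arrow m).tgt
      rw [h] at this
      norm_num [tgt, DoubleWheel.level] at this
    · intro h
      refine turn_half_integer_ne_one (m := m) (position (linkEnd p d)) ?_
      rw [← h, discPoint]
      simp [tgt, DoubleWheel.level, angle]

/-- The arc of an edge as a continuous map. -/
noncomputable def arc (a : Arrow m) : C(unitInterval, ℂ) where
  toFun t := a.curve t
  continuous_toFun := by
    refine (continuousOn_half a.side).comp_continuous ?_ fun t => a.disc_ne_one t.2.1 t.2.2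
    have := continuous_turn (m := m)
    unfold disc
    fun_prop

/-- The radius grows linearly with time, so it determines the time. -/
theorem arc_injective (a : Arrow m) : Function.Injective a.arc := by
  intro t u h
  have := norm_eq_of_half_eq_half (a.norm_disc_le t.2.1 t.2.2) (a.norm_disc_le u.2.1 u.2.2) h
  rw [a.norm_disc t.2.1, a.norm_disc u.2.1] at this
  exact Subtype.ext (by linarith)

/-- Vertices have radius a multiple of `1 / 3`, which an arc attains only at its ends. -/
theorem arc_avoids (a : Arrow m) (t : unitInterval) (v : DoubleWheel m)
    (h : a.arc t = point v) : t = 0 ∨ t = 1 := by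
  have hn := norm_eq_of_half_eq_half (a.norm_disc_le t.2.1 t.2.2) (norm_discPoint_le v) h
  rw [a.norm_disc t.2.1, norm_discPoint] at hn
  have ht : (t : ℝ) = ((DoubleWheel.level v - a.level : ℤ) : ℝ) := by
    push_cast
    linarith
  have h0 : (0 : ℝ) ≤ t := t.2.1
  have h1 : (t : ℝ) ≤ 1 := t.2.2
  rw [ht] at h0 h1
  have h0 : (0 : ℤ) ≤ DoubleWheel.level v - a.level := by exact_mod_cast h0
  have h1 : (DoubleWheel.level v - a.level : ℤ) ≤ 1 := by exact_mod_cast h1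
  rcases (by omega : (DoubleWheel.level v - a.level : ℤ) = 0 ∨
    (DoubleWheel.level v - a.level : ℤ) = 1) with h | h
  · left
    exact Subtype.ext (by rw [ht, h]; simp)
  · right
    exact Subtype.ext (by rw [ht, h]; simp)

/-- At equal times, two arcs meet only if the difference of their slopes makes up the distance
between their starts. Before time `1`, for distinct arcs, only the extreme slopes of neighbouring
starts manage this. The values of `mate` and `crossTime` on other arrows are irrelevant. -/
theorem eq_or_mate_of_turn_eq {a b : Arrow m} {t : ℝ} (ht : 0 < t) (ht1 : t < 1)
    (hs : a.side = b.side) (hl : a.level = b.level)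
    (h : turn m (a.start + a.slope * t) = turn m (b.start + b.slope * t)) :
    b = a ∨ b = a.mate ∧ t = a.crossTime := by
  obtain ⟨n, hn⟩ := turn_eq_turn_iff.1 h.symm
  rcases a with ⟨s, i⟩ | ⟨s, i, d⟩ | ⟨s, p, d⟩ <;>
    rcases b with ⟨s', j⟩ | ⟨s', j, e⟩ | ⟨s', q, e⟩ <;>
    simp [level] at hl <;> simp only [side] at hs <;> subst hs <;> simp only [start, slope] at hn
  · left
    have := val_eq_of_eq (i := j) (j := i) (a := 0) (n := n) (by push_cast; linarith)
    simp [this]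
  · obtain ⟨k, hk⟩ : ∃ k : ℤ, (j.val : ℝ) = i.val + k + m * n :=
      ⟨j.val - i.val - m * n, by push_cast; ring⟩
    have hj : j = i + k := val_eq_of_eq (n := n) (by linarith)
    -- Neighbouring inner vertices are two units of angle apart, and slopes differ by at most `3`,
    -- so `|k| < 2`. For `k = ±1` the slopes must differ by exactly `3`, whence `t = 2 / 3`.
    have hkt : ((d.val : ℝ) - e.val) * t = 2 * k := by linear_combination -hn + 2 * hk
    have hd : (d.val : ℝ) ≤ 3 := by exact_mod_cast (by omega : d.val ≤ 3)
    have he : (e.val : ℝ) ≤ 3 := by exact_mod_cast (by omega : e.val ≤ 3)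
    have hd0 : (0 : ℝ) ≤ d.val := by positivity
    have he0 : (0 : ℝ) ≤ e.val := by positivity
    have hk1 : (k : ℝ) < 2 := by nlinarith
    have hk2 : (-2 : ℝ) < k := by nlinarith
    have hk1 : k < 2 := by exact_mod_cast hk1
    have hk2 : -2 < k := by exact_mod_cast hk2
    rcases (by omega : k = 0 ∨ k = 1 ∨ k = -1) with rfl | rfl | rfl
    · left
      have : (d.val : ℝ) = e.val := by
        have := (mul_eq_zero.1 (hkt.trans (by simp))).resolve_right ht.ne'
        linarith
      have : d = e := Fin.ext (by exact_mod_cast this)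
      simp [this, hj]
    · right
      have : (e.val : ℝ) + 2 < d.val := by push_cast at hkt; nlinarith
      have : e.val + 2 < d.val := by exact_mod_cast this
      obtain rfl : d = 3 := Fin.ext (by show d.val = 3; omega)
      obtain rfl : e = 0 := Fin.ext (by show e.val = 0; simp at this; omega)
      refine ⟨by simp [mate, hj], ?_⟩
      norm_num at hkt
      simp only [crossTime]
      linarith
    · right
      have : (d.val : ℝ) + 2 < e.val := by push_cast at hkt; nlinarith
      have : d.val + 2 < e.val := by exact_mod_cast this
      obtain rfl : e = 3 := Fin.ext (by show e.val = 3; omega)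
      obtain rfl : d = 0 := Fin.ext (by show d.val = 0; simp at this; omega)
      refine ⟨by simp [mate, hj, sub_eq_add_neg], ?_⟩
      norm_num at hkt
      simp only [crossTime]
      linarith
  · obtain ⟨k, hk⟩ : ∃ k : ℤ, position q = position p + k + 2 * m * n :=
      ⟨position q - position p - 2 * m * n, by ring⟩
    have hk' : (position q : ℝ) = position p + k + 2 * m * n := by exact_mod_cast hk
    -- Outer vertices are one unit apart and slopes differ by at most `2`; a crossing needs
    -- difference `2` and `t = 1 / 2`.
    have hkt : ((d.val : ℝ) - e.val) * t = k := by linear_combination -hn + hk'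
    have hd : (d.val : ℝ) ≤ 2 := by exact_mod_cast (by omega : d.val ≤ 2)
    have he : (e.val : ℝ) ≤ 2 := by exact_mod_cast (by omega : e.val ≤ 2)
    have hd0 : (0 : ℝ) ≤ d.val := by positivity
    have he0 : (0 : ℝ) ≤ e.val := by positivity
    have hk1 : (k : ℝ) < 2 := by nlinarith
    have hk2 : (-2 : ℝ) < k := by nlinarith
    have hk1 : k < 2 := by exact_mod_cast hk1
    have hk2 : -2 < k := by exact_mod_cast hk2
    rcases (by omega : k = 0 ∨ k = 1 ∨ k = -1) with rfl | rfl | rfl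
    · left
      have : (d.val : ℝ) = e.val := by
        have := (mul_eq_zero.1 (hkt.trans (by simp))).resolve_right ht.ne'
        linarith
      have : d = e := Fin.ext (by exact_mod_cast this)
      have hq : q = p := eq_of_position_eq (n := n) (by linarith)
      simp [this, hq]
    · right
      have : (e.val : ℝ) + 1 < d.val := by push_cast at hkt; nlinarith
      have : e.val + 1 < d.val := by exact_mod_cast this
      obtain rfl : d = 2 := Fin.ext (by show d.val = 2; omega)
      obtain rfl : e = 0 := Fin.ext (by show e.val = 0; simp at this; omega)
      obtain ⟨n', hn'⟩ := exists_position_next p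
      have hq : q = next p := eq_of_position_eq (n := n - n') (by rw [hk, hn']; ring)
      refine ⟨by simp [mate, hq], ?_⟩
      norm_num at hkt
      simp only [crossTime]
      linarith
    · right
      have : (d.val : ℝ) + 1 < e.val := by push_cast at hkt; nlinarith
      have : d.val + 1 < e.val := by exact_mod_cast this
      obtain rfl : e = 2 := Fin.ext (by show e.val = 2; omega)
      obtain rfl : d = 0 := Fin.ext (by show d.val = 0; simp at this; omega)
      obtain ⟨n', hn'⟩ := exists_position_next_symm p
      have hq : q = next.symm p := eq_of_position_eq (n := n - n') (by rw [hk, hn']; ring)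
      refine ⟨by simp [mate, hq], ?_⟩
      norm_num at hkt
      simp only [crossTime]
      linarith

/-- Equal radii at interior times force the same level and the same time, which leaves a comparison
of angles. -/
theorem eq_or_mate_of_arc_eq {a b : Arrow m} {t u : unitInterval} (ht : t ∈ Set.Ioo 0 1)
    (hu : u ∈ Set.Ioo 0 1) (h : a.arc t = b.arc u) :
    b = a ∨ b = a.mate ∧ (t : ℝ) = a.crossTime := by
  have ht0 : (0 : ℝ) < t := ht.1
  have ht1 : (t : ℝ) < 1 := ht.2
  have hu0 : (0 : ℝ) < u := hu.1
  have hu1 : (u : ℝ) < 1 := hu.2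
  obtain ⟨hs, hz⟩ := half_eq_half (a.norm_disc_lt ht0.le ht1) (b.norm_disc_lt hu0.le hu1) h
  have hn := congrArg norm hz
  rw [a.norm_disc ht0.le, b.norm_disc hu0.le] at hn
  have hl : a.level = b.level := by
    have h1 : (a.level : ℝ) < b.level + 1 := by linarith
    have h2 : (b.level : ℝ) < a.level + 1 := by linarith
    have h1 : a.level < b.level + 1 := by exact_mod_cast h1
    have h2 : b.level < a.level + 1 := by exact_mod_cast h2
    omega
  have htu : (t : ℝ) = u := by
    rw [hl] at hn
    linarith
  refine eq_or_mate_of_turn_eq ht0 ht1 hs hl ?_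
  rw [disc, disc, ← hl, ← htu] at hz
  exact mul_left_cancel₀ (ofReal_ne_zero.2 (by positivity)) hz

end Arrow

/-- For a given edge, both the crossing edge and the crossing point are determined by its arrow. -/
theorem isOnePlanar : (graph m).IsOnePlanar := by
  choose arrow harrow using exists_arrow (m := m)
  have hinj : ∀ e f, arrow e = arrow f → e = f := fun e f h =>
    Subtype.ext (by rw [← harrow e, ← harrow f, h])
  refine ⟨⟨point, point_injective, fun e => (arrow e).arc, fun e => (arrow e).arc_injective,
    fun e => ?_, fun e t v h => (arrow e).arc_avoids t v h⟩, ?_⟩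
  · rw [← harrow e]
    have h0 : (arrow e).arc 0 = point (arrow e).src := (arrow e).curve_zero
    have h1 : (arrow e).arc 1 = point (arrow e).tgt := (arrow e).curve_one
    rw [h0, h1]
    rfl
  · have key : ∀ e f z, (f ≠ e ∧ (∃ t ∈ Set.Ioo 0 1, (arrow e).arc t = z) ∧
        ∃ u ∈ Set.Ioo 0 1, (arrow f).arc u = z) →
        arrow f = (arrow e).mate ∧ z = (arrow e).curve (arrow e).crossTime := by
      rintro e f z ⟨hne, ⟨t, ht, rfl⟩, u, hu, h⟩
      rcases Arrow.eq_or_mate_of_arc_eq ht hu h.symm with h | ⟨h1, h2⟩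
      · exact absurd (hinj _ _ h) hne
      · exact ⟨h1, by rw [← h2]; rfl⟩
    rintro e ⟨f, z⟩ hf ⟨g, w⟩ hg
    obtain ⟨h1, h2⟩ := key e f z hf
    obtain ⟨h3, h4⟩ := key e g w hg
    rw [hinj f g (h1.trans h3.symm), h2, h4]

end DoubleWheel

/-! ### Assembly of the examples -/

theorem theorem1p2 (k : ℕ) (hk : 0 < k) (hk5 : k ≤ 5) :
    ∃ (n : ℕ → ℕ) (G : ∀ i, SimpleGraph (Fin (n i))),
      (∀ i j, i ≠ j → IsEmpty (G i ≃g G j)) ∧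
      ∀ i, ¬ (G i).IsHamiltonian ∧ (G i).IsOnePlanar ∧ (G i).IsPerfect ∧
        (G i).connectivity = k := by
  have main : ∀ i : ℕ, ∃ G : SimpleGraph (Fin (8 * (i + 10) + 2)),
      ¬ G.IsHamiltonian ∧ G.IsOnePlanar ∧ G.IsPerfect ∧ G.connectivity = k := by
    intro i
    obtain ⟨N, hN, hcard⟩ := DoubleWheel.exists_neighbors_outer (m := i + 10) (by omega)
    obtain ⟨H, hH, hconn⟩ := SimpleGraph.exists_le_connectivity_eq
      (DoubleWheel.not_isSeparator (m := i + 10) (by omega))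
      (by rw [DoubleWheel.card_eq]; omega) _ N hN hcard hk hk5
    -- `H` is relabelled by `Fin`; it keeps all vertices of the double wheel, so the class sizes are
    -- unchanged.
    let e := (Fintype.equivFinOfCardEq (DoubleWheel.card_eq (m := i + 10))).symm
    let f : H.comap e ≃g H := SimpleGraph.Iso.comap e H
    let g : H.comap e →g DoubleWheel.graph (i + 10) :=
      (SimpleGraph.Hom.ofLE hH).comp f.toHom
    let c : (H.comap e).Coloring Bool := (DoubleWheel.coloring (i + 10)).comp g
    have hcolor : ∀ b, Fintype.card {v // c v = b} =
        if b then 4 * (i + 10) + 2 else 4 * (i + 10) := fun b => by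
      rw [← DoubleWheel.card_color b]
      exact Fintype.card_congr (e.subtypeEquiv fun v => Iff.rfl)
    refine ⟨H.comap e, fun hham => ?_, DoubleWheel.isOnePlanar.of_hom g e.injective, c.isPerfect,
      f.connectivity_eq.trans hconn⟩
    have := hham.card_colorClass_eq (by rw [Fintype.card_fin]; omega) c
    rw [hcolor, hcolor] at this
    simp at this
  choose G hG using main
  -- Different indices give different orders, so no two graphs are isomorphic.
  refine ⟨fun i => 8 * (i + 10) + 2, G, fun i j hij => ⟨fun e => hij ?_⟩, hG⟩
  have := Fintype.card_congr e.toEquiv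
  simp only [Fintype.card_fin] at this
  omega
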